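/- Let $F$ be a finite field with $q$ elements, $\operatorname{char} F\neq 2$, let $E$ be its quadratic extension with norm $N$, trace $\mathrm{Tr}$ and conjugation $\bar z=z^q$, and let $U=\{u\in E^\times : N(u)=1\}$. Let $G=\mathrm{GL}(2,F)$ and let $K\subset G$ be the Coxeter torus, i.e. the group of matrices of the maps $w\mapsto zw$ $(z\in E^\times)$ in an $F$-basis $(1,\delta)$ of $E$ with $\mathrm{Tr}(\delta)=0$. Let $\Lambda$ be a complex character of $E^\times$ with $\Lambda^q\neq\Lambda$ whose restriction to $F^\times$ is trivial, let $\chi_\Lambda$ be the character of the $(q-1)$-dimensional cuspidal representation of $G$ attached to $\Lambda$, and let $$\zeta_\Lambda(g)=\frac1{|K|}\sum_{k\in K}\chi_\Lambda(kg)\qquad(g\in G)$$ be the corresponding spherical function for $\Phi=\mathbf 1$. Write $\zeta_\Lambda(a)=\zeta_\Lambda\left(\begin{pmatrix}a&0\\0&1\end{pmatrix}\right)$ for $a\in F^\times$. Then there is a unique character $\omega$ of $U$ with $\Lambda(z)=\omega(z/\bar z)$ for all $z\in E^\times$, and for every $a\in F^\times$ with $a\neq 1$ and $a\neq -1$, $$\zeta_\Lambda(a)=(q+1)^{-1}\sum_{u\in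 U}\varepsilon\bigl(\mathrm{Tr}(u)-(a+a^{-1})\bigr)\,(\varepsilon\omega)(u).$$ Here, on $F$, $\varepsilon$ is the sign (quadratic) character of $F^\times$, extended by $\varepsilon(0)=0$, and in the factor $(\varepsilon\omega)(u)=\varepsilon(u)\omega(u)$, $\varepsilon$ is the sign character of the cyclic group $U$, i.e. its character of order two. -/

import Mathlib

open scoped MatrixGroups

namespace FinitePoincare

section Fields

variable {F E : Type*} [Field F] [Fintype F] [DecidableEq F]
  [Field E] [Fintype E] [DecidableEq E] [Algebra F E]

/-- The trace form of the quadratic extension: `N (s + t) = N s + Tr (s * t̄) + N t`,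
where `t̄ = t ^ q`. -/
theorem norm_add_eq (hE : Module.finrank F E = 2) (s t : E) :
    Algebra.norm F (s + t) = Algebra.norm F s
      + Algebra.trace F E (s * t ^ Fintype.card F) + Algebra.norm F t := by
  apply (algebraMap F E).injective
  simp only [map_add, FiniteField.algebraMap_norm_eq_prod_pow,
    FiniteField.algebraMap_trace_eq_sum_pow, hE, Finset.prod_range_succ, Finset.prod_range_zero,
    Finset.sum_range_succ, Finset.sum_range_zero, Nat.card_eq_fintype_card, pow_zero, pow_one]
  have h1 : (s + t) ^ Fintype.card F = s ^ Fintype.card F + t ^ Fintype.card F := by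
    simpa using map_add (FiniteField.frobeniusAlgHom F E) s t
  have h2 : (t ^ Fintype.card F) ^ Fintype.card F = t := by
    rw [← pow_mul, ← pow_two, ← hE, ← Module.card_eq_pow_finrank (K := F), FiniteField.pow_card]
  rw [h1, mul_pow, h2]
  ring

theorem conj_conj (hE : Module.finrank F E = 2) (t : E) :
    (t ^ Fintype.card F) ^ Fintype.card F = t := by
  rw [← pow_mul, ← pow_two, ← hE, ← Module.card_eq_pow_finrank (K := F), FiniteField.pow_card]

theorem norm_conj (t : E) :
    Algebra.norm F (t ^ Fintype.card F) = Algebra.norm F t := by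
  rw [map_pow, FiniteField.pow_card]

theorem trace_conj (hE : Module.finrank F E = 2) (t : E) :
    Algebra.trace F E (t ^ Fintype.card F) = Algebra.trace F E t := by
  apply (algebraMap F E).injective
  simp only [FiniteField.algebraMap_trace_eq_sum_pow, hE,
    Finset.sum_range_succ, Finset.sum_range_zero, Nat.card_eq_fintype_card, pow_zero, pow_one,
    conj_conj hE]
  ring

/-- The elements of `Eˣ` of norm `n`. -/
noncomputable def normFibre (n : F) : Finset Eˣ :=
  Finset.univ.filter fun t : Eˣ => Algebra.norm F (t : E) = n

theorem mem_normFibre {n : F} {t : Eˣ} :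
    t ∈ normFibre (E := E) n ↔ Algebra.norm F (t : E) = n := by
  simp [normFibre]

/-- A character of `E` that is not fixed by Frobenius sums to zero on the fibres of the norm. -/
theorem sum_norm_fibre_eq_zero {Λ : MulChar E ℂ} (hΛ : Λ ^ Fintype.card F ≠ Λ) (n : F) :
    ∑ r ∈ normFibre (E := E) n, Λ r = 0 := by
  obtain ⟨z, hz⟩ : ∃ z : Eˣ, Λ (z ^ Fintype.card F : E) ≠ Λ z := by
    by_contra! h
    apply hΛ
    ext z
    rw [← h z, MulChar.pow_apply_coe, map_pow]
  set u : Eˣ := z ^ Fintype.card F / z with hu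
  have hNu : Algebra.norm F (u : E) = 1 := by
    have : (u : E) * z = (z : E) ^ Fintype.card F := by simp [hu]
    have h2 := congrArg (Algebra.norm F) this
    rw [norm_conj, map_mul] at h2
    exact mul_eq_right₀ (Algebra.norm_ne_zero_iff.2 z.ne_zero) |>.1 h2
  have hNu' : Algebra.norm F ((u⁻¹ : Eˣ) : E) = 1 := by
    have h2 : Algebra.norm F (((u⁻¹ : Eˣ) : E) * u) = 1 := by simp
    rwa [map_mul, hNu, mul_one] at h2
  have hΛu : Λ u ≠ 1 := by
    intro h
    apply hz
    have : (u : E) * z = (z : E) ^ Fintype.card F := by simp [hu]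
    rw [← this, map_mul, h, one_mul]
  have key : ∑ r ∈ normFibre (E := E) n, Λ r
      = Λ u * ∑ r ∈ normFibre (E := E) n, Λ r := by
    rw [Finset.mul_sum]
    symm
    refine Finset.sum_nbij' (fun r => u * r) (fun r => u⁻¹ * r) ?_ ?_ ?_ ?_ ?_
    · intro r hr
      rw [mem_normFibre] at hr ⊢; rw [Units.val_mul, map_mul, hNu, one_mul, hr]
    · intro r hr
      rw [mem_normFibre] at hr ⊢; rw [Units.val_mul, map_mul, hNu', one_mul, hr]
    · intro r _; simp
    · intro r _; simp
    · intro r _; simp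
  by_contra h0
  exact hΛu (mul_right_cancel₀ h0 (by rw [one_mul]; exact key.symm))

/-- The Gauss sum of the norm form. -/
theorem sum_norm_form (hE : Module.finrank F E = 2) {ψ : AddChar F ℂ} (hψ : ψ ≠ 1) {α : F}
    (hα : α ≠ 0) : ∑ s : E, ψ (α * Algebra.norm F s) = -(Fintype.card F : ℂ) := by
  have hcE : (Fintype.card E : ℂ) = (Fintype.card F : ℂ) ^ 2 := by
    rw [Module.card_eq_pow_finrank (K := F) (V := E), hE]; push_cast; rfl
  have hconst : ∀ α : F, α ≠ 0 →
      ∑ s : E, ψ (α * Algebra.norm F s) = ∑ s : E, ψ (Algebra.norm F s) := by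
    intro α hα
    obtain ⟨γ, hγ⟩ := FiniteField.norm_surjective F E α
    have hγ0 : γ ≠ 0 := by
      rintro rfl
      exact hα (by rw [← hγ, Algebra.norm_zero])
    refine Fintype.sum_equiv (Equiv.mulLeft₀ γ hγ0) _ _ fun s => ?_
    simp [hγ]
  have htot : ∑ α : F, ∑ s : E, ψ (α * Algebra.norm F s) = (Fintype.card F : ℂ) := by
    rw [Finset.sum_comm]
    have : ∀ s : E, ∑ α : F, ψ (α * Algebra.norm F s)
        = if s = 0 then (Fintype.card F : ℂ) else 0 := by
      intro s
      rw [AddChar.sum_mulShift _ (AddChar.IsPrimitive.of_ne_one hψ)]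
      simp [Algebra.norm_eq_zero_iff]
    simp [this]
  have hsplit : ∑ α : F, ∑ s : E, ψ (α * Algebra.norm F s)
      = (Fintype.card F : ℂ) ^ 2
        + ((Fintype.card F : ℂ) - 1) * ∑ s : E, ψ (Algebra.norm F s) := by
    rw [← Finset.add_sum_erase _ _ (Finset.mem_univ (0 : F)),
      Finset.sum_congr rfl fun α hα => hconst α (Finset.ne_of_mem_erase hα)]
    simp [hcE, Finset.card_erase_of_mem, Nat.cast_sub Fintype.card_pos]
  rw [hconst α hα]
  have hq : (Fintype.card F : ℂ) - 1 ≠ 0 := by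
    rw [sub_ne_zero]
    exact_mod_cast (Fintype.one_lt_card (α := F)).ne'
  apply mul_left_cancel₀ hq
  linear_combination hsplit.symm.trans htot

/-- The quadratic Gauss sum obtained from the norm form by completing the square. -/
theorem sum_norm_trace (hE : Module.finrank F E = 2) {ψ : AddChar F ℂ} (hψ : ψ ≠ 1) {α : F}
    (hα : α ≠ 0) (β : E) :
    ∑ s : E, ψ (α * Algebra.norm F s + Algebra.trace F E (s * β))
      = -(Fintype.card F : ℂ) * ψ (-(Algebra.norm F β / α)) := by
  rw [← sum_norm_form hE hψ hα, Finset.sum_mul]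
  set γ : E := algebraMap F E α⁻¹ * β ^ Fintype.card F with hγ
  refine Fintype.sum_equiv (Equiv.addRight γ) _ _ fun s => ?_
  rw [← AddChar.map_add_eq_mul]
  congr 1
  have h1 : γ ^ Fintype.card F = algebraMap F E α⁻¹ * β := by
    rw [hγ, mul_pow, conj_conj hE, ← map_pow, FiniteField.pow_card]
  have h2 : Algebra.norm F γ = α⁻¹ ^ 2 * Algebra.norm F β := by
    rw [hγ, map_mul, norm_conj, Algebra.norm_algebraMap, hE]
  have h3 : s * (algebraMap F E α⁻¹ * β) = α⁻¹ • (s * β) := by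
    rw [Algebra.smul_def]; ring
  rw [Equiv.coe_addRight, norm_add_eq hE, h1, h2, h3, map_smul, smul_eq_mul]
  field_simp
  ring

theorem sum_trace (hE : Module.finrank F E = 2) {ψ : AddChar F ℂ} (hψ : ψ ≠ 1) (β : E) :
    ∑ s : E, ψ (Algebra.trace F E (s * β))
      = if β = 0 then (Fintype.card F : ℂ) ^ 2 else 0 := by
  have hcE : (Fintype.card E : ℂ) = (Fintype.card F : ℂ) ^ 2 := by
    rw [Module.card_eq_pow_finrank (K := F) (V := E), hE]; push_cast; rfl
  split_ifs with hβ
  · simp [hβ, hcE]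
  · have hψ' : ψ.compAddMonoidHom (Algebra.trace F E).toAddMonoidHom ≠ 1 := by
      intro h
      apply hψ
      ext x
      obtain ⟨y, rfl⟩ := Algebra.trace_surjective F E x
      simpa using DFunLike.congr_fun h y
    rw [← AddChar.sum_eq_zero_of_ne_one hψ']
    refine Fintype.sum_equiv (Equiv.mulRight₀ β hβ) _ _ fun s => ?_
    simp

/-- Summing over `Eˣ` instead of `E`. -/
theorem sum_units (f : E → ℂ) : ∑ s : Eˣ, f s = ∑ s : E, f s - f 0 := by
  rw [← Finset.sum_erase_eq_sub (Finset.mem_univ (0 : E))]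
  refine Finset.sum_bij (fun s _ => (s : E)) ?_ ?_ ?_ ?_
  · intro s _; simp
  · intro s _ t _ h; exact Units.ext h
  · intro s hs; exact ⟨Units.mk0 s (Finset.ne_of_mem_erase hs), Finset.mem_univ _, rfl⟩
  · intro s _; rfl

/-- Matrix coefficients, in the basis of point masses on `Fˣ`, of the operator by which
`(a, b; c, d)` acts in the Kirillov model of the cuspidal representation attached to `Λ`.
For `c = 0` this is the operator `f ↦ (x ↦ Λ d * ψ (b * x / d) * f (a * x / d))`. -/
noncomputable def kirillovKernel (ψ : AddChar F ℂ) (Λ : MulChar E ℂ) (a b c d : F) :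
    Matrix Fˣ Fˣ ℂ := fun x y =>
  if c = 0 then
    if a * x = d * y then Λ (algebraMap F E d) * ψ (b * x / d) else 0
  else
    -(Fintype.card F : ℂ)⁻¹ * ψ ((a * x + d * y) / c) *
      ∑ t ∈ normFibre (E := E) (x / y * (a * d - b * c)),
        Λ t * ψ (-(y / c * Algebra.trace F E (t : E)))

theorem kirillovKernel_one (ψ : AddChar F ℂ) (Λ : MulChar E ℂ) :
    kirillovKernel ψ Λ 1 0 0 1 = 1 := by
  ext x y
  simp [kirillovKernel, Matrix.one_apply, Units.ext_iff]

/-- Rescaling a norm fibre by an element of `F`. -/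
theorem sum_normFibre_smul (hE : Module.finrank F E = 2) {e : F} (he : e ≠ 0) {m n : F}
    (h : e ^ 2 * m = n) (f : E → ℂ) :
    ∑ t ∈ normFibre (E := E) n, f t = ∑ t ∈ normFibre (E := E) m, f (algebraMap F E e * t) := by
  subst h
  have he' : algebraMap F E e ≠ 0 := by simpa using he
  set u : Eˣ := Units.mk0 (algebraMap F E e) he' with hu
  have hN : Algebra.norm F (u : E) = e ^ 2 := by
    rw [hu, Units.val_mk0, Algebra.norm_algebraMap, hE]
  symm
  refine Finset.sum_nbij' (fun t => u * t) (fun t => u⁻¹ * t) ?_ ?_ ?_ ?_ ?_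
  · intro t ht
    rw [mem_normFibre] at ht ⊢
    rw [Units.val_mul, map_mul, hN, ht]
  · intro t ht
    rw [mem_normFibre] at ht ⊢
    apply mul_left_cancel₀ (pow_ne_zero 2 he)
    rw [← hN, ← map_mul, ← Units.val_mul, mul_inv_cancel_left, ht, hN]
  · intro t _; simp
  · intro t _; simp
  · intro t _; simp [hu]

theorem kirillovKernel_of_eq (ψ : AddChar F ℂ) (Λ : MulChar E ℂ) {a b c d : F} (hc : c = 0)
    {x y : Fˣ} (h : a * x = d * y) :
    kirillovKernel ψ Λ a b c d x y = Λ (algebraMap F E d) * ψ (b * x / d) := by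
  rw [kirillovKernel, if_pos hc, if_pos h]

theorem kirillovKernel_of_ne (ψ : AddChar F ℂ) (Λ : MulChar E ℂ) {a b c d : F} (hc : c = 0)
    {x y : Fˣ} (h : a * x ≠ d * y) : kirillovKernel ψ Λ a b c d x y = 0 := by
  rw [kirillovKernel, if_pos hc, if_neg h]

theorem kirillovKernel_of_ne_zero (ψ : AddChar F ℂ) (Λ : MulChar E ℂ) {a b c d : F} (hc : c ≠ 0)
    (x y : Fˣ) :
    kirillovKernel ψ Λ a b c d x y = -(Fintype.card F : ℂ)⁻¹ * ψ ((a * x + d * y) / c) *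
      ∑ t ∈ normFibre (E := E) (x / y * (a * d - b * c)),
        Λ t * ψ (-(y / c * Algebra.trace F E (t : E))) := by
  rw [kirillovKernel, if_neg hc]

theorem kirillovKernel_mul_upper_left (hE : Module.finrank F E = 2)
    (ψ : AddChar F ℂ) (Λ : MulChar E ℂ) {a b d : F}
    (ha : a ≠ 0) (hd : d ≠ 0) {a' b' c' d' : F} (h' : a' * d' - b' * c' ≠ 0) :
    kirillovKernel ψ Λ a b 0 d * kirillovKernel ψ Λ a' b' c' d'
      = kirillovKernel ψ Λ (a * a' + b * c') (a * b' + b * d') (d * c') (d * d') := by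
  ext x z
  obtain ⟨y, hy⟩ : ∃ y : Fˣ, a * (x : F) = d * y :=
    ⟨Units.mk0 (a * x / d) (div_ne_zero (mul_ne_zero ha x.ne_zero) hd), by
      rw [Units.val_mk0]; field_simp⟩
  have hx0 := x.ne_zero
  have hy0 := y.ne_zero
  have hz0 := z.ne_zero
  rw [Matrix.mul_apply, Finset.sum_eq_single y]
  rotate_left
  · intro y' _ hy'
    rw [kirillovKernel_of_ne ψ Λ rfl, zero_mul]
    intro h
    exact hy' (Units.ext (mul_left_cancel₀ hd (h.symm.trans hy)))
  · simp
  rw [kirillovKernel_of_eq ψ Λ rfl hy]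
  have hxy : (x : F) = d * y / a := by field_simp; linear_combination hy
  by_cases hc : c' = 0
  · subst hc
    have hd' : d' ≠ 0 := by rintro rfl; simp at h'
    by_cases h : a' * (y : F) = d' * z
    · rw [kirillovKernel_of_eq ψ Λ rfl h, kirillovKernel_of_eq ψ Λ (mul_zero d)
        (by linear_combination a' * hy + d * h), map_mul, map_mul, mul_mul_mul_comm,
        ← AddChar.map_add_eq_mul]
      congr 2
      rw [hxy]
      field_simp
      ring
    · rw [kirillovKernel_of_ne ψ Λ rfl h, kirillovKernel_of_ne ψ Λ (mul_zero d), mul_zero]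
      intro h3
      apply h
      apply mul_left_cancel₀ hd
      linear_combination h3 - a' * hy
  · rw [kirillovKernel_of_ne_zero ψ Λ hc, kirillovKernel_of_ne_zero ψ Λ (mul_ne_zero hd hc),
      sum_normFibre_smul hE hd (m := y / z * (a' * d' - b' * c'))
        (by rw [hxy]; field_simp; ring)
        (fun t => Λ t * ψ (-(z / (d * c') * Algebra.trace F E t)))]
    have hT : ∀ t : E, Λ (algebraMap F E d * t) *
        ψ (-(z / (d * c') * Algebra.trace F E (algebraMap F E d * t)))
        = Λ (algebraMap F E d) * (Λ t * ψ (-(z / c' * Algebra.trace F E t))) := by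
      intro t
      rw [map_mul, ← Algebra.smul_def, map_smul, smul_eq_mul, mul_assoc]
      congr 3
      field_simp
    simp only [hT]
    rw [← Finset.mul_sum]
    have hP : ψ (((a * a' + b * c') * x + d * d' * z) / (d * c'))
        = ψ (b * x / d) * ψ ((a' * y + d' * z) / c') := by
      rw [← AddChar.map_add_eq_mul]
      congr 1
      rw [hxy]
      field_simp
      ring
    rw [hP]
    ring

theorem kirillovKernel_mul_upper_right (hE : Module.finrank F E = 2)
    (ψ : AddChar F ℂ) (Λ : MulChar E ℂ) {a b c d : F} (hc : c ≠ 0)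
    {a' b' d' : F} (ha' : a' ≠ 0) (hd' : d' ≠ 0) :
    kirillovKernel ψ Λ a b c d * kirillovKernel ψ Λ a' b' 0 d'
      = kirillovKernel ψ Λ (a * a') (a * b' + b * d') (c * a') (c * b' + d * d') := by
  ext x z
  obtain ⟨y, hy⟩ : ∃ y : Fˣ, a' * (y : F) = d' * z :=
    ⟨Units.mk0 (d' * z / a') (div_ne_zero (mul_ne_zero hd' z.ne_zero) ha'), by
      rw [Units.val_mk0]; field_simp⟩
  have hx0 := x.ne_zero
  have hy0 := y.ne_zero
  have hz0 := z.ne_zero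
  rw [Matrix.mul_apply, Finset.sum_eq_single y]
  rotate_left
  · intro y' _ hy'
    rw [kirillovKernel_of_ne ψ Λ rfl (x := y'), mul_zero]
    intro h
    exact hy' (Units.ext (mul_left_cancel₀ ha' (h.trans hy.symm)))
  · simp
  have hyz : (y : F) = d' * z / a' := by field_simp; linear_combination hy
  rw [kirillovKernel_of_eq ψ Λ rfl hy, kirillovKernel_of_ne_zero ψ Λ hc,
    kirillovKernel_of_ne_zero ψ Λ (mul_ne_zero hc ha'),
    sum_normFibre_smul hE hd' (m := x / y * (a * d - b * c))
      (by rw [hyz]; field_simp; ring)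
      (fun t => Λ t * ψ (-(z / (c * a') * Algebra.trace F E t)))]
  have hT : ∀ t : E, Λ (algebraMap F E d' * t) *
      ψ (-(z / (c * a') * Algebra.trace F E (algebraMap F E d' * t)))
      = Λ (algebraMap F E d') * (Λ t * ψ (-(y / c * Algebra.trace F E t))) := by
    intro t
    rw [map_mul, ← Algebra.smul_def, map_smul, smul_eq_mul, mul_assoc]
    congr 3
    rw [hyz]
    field_simp
  simp only [hT]
  rw [← Finset.mul_sum]
  have hP : ψ ((a * a' * x + (c * b' + d * d') * z) / (c * a'))
      = ψ ((a * x + d * y) / c) * ψ (b' * y / d') := by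
    rw [← AddChar.map_add_eq_mul]
    congr 1
    rw [hyz]
    field_simp
    ring
  rw [hP]
  ring

theorem mul_conj (hE : Module.finrank F E = 2) (s : E) :
    s * s ^ Fintype.card F = algebraMap F E (Algebra.norm F s) := by
  simp [FiniteField.algebraMap_norm_eq_prod_pow, hE, Finset.prod_range_succ]

/-- The product of two kernels off the Borel subgroup, as a sum over `E`. -/
theorem kirillovKernel_mul_aux (hE : Module.finrank F E = 2)
    (ψ : AddChar F ℂ) {Λ : MulChar E ℂ} (hΛ : Λ ^ Fintype.card F ≠ Λ) {a b c d : F} (hc : c ≠ 0)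
    {a' b' c' d' : F} (hc' : c' ≠ 0) (h' : a' * d' - b' * c' ≠ 0) (x z : Fˣ) :
    (kirillovKernel ψ Λ a b c d * kirillovKernel ψ Λ a' b' c' d') x z
      = (Fintype.card F : ℂ)⁻¹ ^ 2 * ψ (a * x / c + d' * z / c') *
        ∑ r ∈ normFibre (E := E) (x / z * (a * d - b * c) * (a' * d' - b' * c')), Λ r *
          ∑ s : E, ψ ((c * a' + d * c') / (c * c') * z / (a' * d' - b' * c') * Algebra.norm F s
            + Algebra.trace F E (s * (-(algebraMap F E (z / (c * (a' * d' - b' * c')))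
                * (r : E) ^ Fintype.card F) - algebraMap F E (z / c')))) := by
  set D := a * d - b * c with hD
  set D' := a' * d' - b' * c' with hD'
  have hz0 := z.ne_zero
  set T : E → E → ℂ := fun r s => ψ ((c * a' + d * c') / (c * c') * z / D' * Algebra.norm F s
            + Algebra.trace F E (s * (-(algebraMap F E (z / (c * D'))
                * r ^ Fintype.card F) - algebraMap F E (z / c')))) with hT
  have h1 : ∑ r ∈ normFibre (E := E) (x / z * D * D'), Λ r * ∑ s : E, T r s
      = ∑ r ∈ normFibre (E := E) (x / z * D * D'), ∑ s : Eˣ, Λ r * T r s := by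
    have h0 : ∀ r : E, T r 0 = 1 := by intro r; simp [hT, Algebra.norm_zero]
    simp only [← Finset.mul_sum, sum_units, h0, mul_sub, mul_one, Finset.sum_sub_distrib,
      sum_norm_fibre_eq_zero hΛ, sub_zero]
  rw [h1, Matrix.mul_apply]
  simp only [kirillovKernel_of_ne_zero ψ Λ hc, kirillovKernel_of_ne_zero ψ Λ hc', ← hD, ← hD']
  have h2 : ∀ y : Fˣ, -(Fintype.card F : ℂ)⁻¹ * ψ ((a * x + d * y) / c) *
      (∑ t ∈ normFibre (E := E) (x / y * D), Λ t * ψ (-(y / c * Algebra.trace F E (t : E)))) *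
      (-(Fintype.card F : ℂ)⁻¹ * ψ ((a' * y + d' * z) / c') *
      ∑ s ∈ normFibre (E := E) (y / z * D'), Λ s * ψ (-(z / c' * Algebra.trace F E (s : E))))
      = (Fintype.card F : ℂ)⁻¹ ^ 2 *
        ∑ p ∈ normFibre (E := E) (x / y * D) ×ˢ normFibre (E := E) (y / z * D'),
          ψ ((a * x + d * y) / c) * ψ ((a' * y + d' * z) / c') *
          (Λ p.1 * ψ (-(y / c * Algebra.trace F E (p.1 : E))) *
          (Λ p.2 * ψ (-(z / c' * Algebra.trace F E (p.2 : E))))) := by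
    intro y
    rw [← Finset.mul_sum, Finset.sum_product]
    simp only [← Finset.sum_mul_sum]
    ring
  simp only [h2]
  rw [← Finset.mul_sum, mul_assoc, Finset.sum_sigma', ← Finset.sum_product']
  congr 1
  rw [Finset.mul_sum]
  have hj : ∀ s : Eˣ, (z : F) * Algebra.norm F (s : E) / D' ≠ 0 := fun s =>
    div_ne_zero (mul_ne_zero hz0 (Algebra.norm_ne_zero_iff.2 s.ne_zero)) h'
  refine Finset.sum_nbij' (fun w => (w.2.1 * w.2.2, w.2.2))
    (fun w => ⟨Units.mk0 _ (hj w.2), (w.1 / w.2, w.2)⟩) ?_ ?_ ?_ ?_ ?_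
  · rintro ⟨y, t, s⟩ hw
    simp only [Finset.mem_sigma, Finset.mem_product, mem_normFibre, Finset.mem_univ,
      true_and] at hw
    have hy0 := y.ne_zero
    simp only [Finset.mem_product, mem_normFibre, Finset.mem_univ, and_true, Units.val_mul,
      map_mul, hw.1, hw.2]
    field_simp
  · rintro ⟨r, s⟩ hw
    simp only [Finset.mem_product, mem_normFibre, Finset.mem_univ, and_true] at hw
    have hs : Algebra.norm F (s : E) ≠ 0 := Algebra.norm_ne_zero_iff.2 s.ne_zero
    simp only [Finset.mem_sigma, Finset.mem_product, mem_normFibre, Finset.mem_univ,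
      true_and, Units.val_mk0]
    constructor
    · apply mul_right_cancel₀ hs
      rw [← map_mul, ← Units.val_mul, div_mul_cancel, hw]
      field_simp
    · field_simp
  · rintro ⟨y, t, s⟩ hw
    simp only [Finset.mem_sigma, Finset.mem_product, mem_normFibre, Finset.mem_univ,
      true_and] at hw
    have : Units.mk0 _ (hj s) = y := by
      ext
      rw [Units.val_mk0, hw.2]
      field_simp
    simp [this]
  · rintro ⟨r, s⟩ hw
    simp
  · rintro ⟨y, t, s⟩ hw
    simp only [Finset.mem_sigma, Finset.mem_product, mem_normFibre, Finset.mem_univ,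
      true_and] at hw
    simp only [hT]
    have hy0 := y.ne_zero
    have e1 : Algebra.trace F E ((s : E) * (-(algebraMap F E (z / (c * D'))
                * ((t * s : Eˣ) : E) ^ Fintype.card F) - algebraMap F E (z / c')))
        = -(y / c * Algebra.trace F E (t : E)) - z / c' * Algebra.trace F E (s : E) := by
      have : (s : E) * (-(algebraMap F E (z / (c * D'))
                * ((t * s : Eˣ) : E) ^ Fintype.card F) - algebraMap F E (z / c'))
          = -((z / (c * D') * Algebra.norm F (s : E)) • (t : E) ^ Fintype.card F)
            - (z / c') • (s : E) := by
        rw [Algebra.smul_def, Algebra.smul_def, map_mul, ← mul_conj hE, Units.val_mul]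
        ring
      rw [this, map_sub, map_neg, map_smul, map_smul, trace_conj hE, hw.2, smul_eq_mul,
        smul_eq_mul]
      field_simp
    rw [e1, hw.2, Units.val_mul, map_mul]
    have e2 : ψ ((a * x + d * y) / c) * ψ ((a' * y + d' * z) / c') *
          (Λ t * ψ (-(y / c * Algebra.trace F E (t : E))) *
          (Λ s * ψ (-(z / c' * Algebra.trace F E (s : E)))))
        = Λ t * Λ s * (ψ ((a * x + d * y) / c) * ψ ((a' * y + d' * z) / c') *
          (ψ (-(y / c * Algebra.trace F E (t : E))) *
          ψ (-(z / c' * Algebra.trace F E (s : E))))) := by ring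
    have e3 : ∀ u v : ℂ, ψ (a * x / c + d' * z / c') * (u * v)
        = u * (ψ (a * x / c + d' * z / c') * v) := by intro u v; ring
    rw [e2, e3]
    simp only [← AddChar.map_add_eq_mul]
    congr 2
    field_simp
    ring

theorem kirillovKernel_mul_generic (hE : Module.finrank F E = 2)
    {ψ : AddChar F ℂ} (hψ : ψ ≠ 1) {Λ : MulChar E ℂ} (hΛ : Λ ^ Fintype.card F ≠ Λ)
    {a b c d : F} (hc : c ≠ 0)
    {a' b' c' d' : F} (hc' : c' ≠ 0) (h' : a' * d' - b' * c' ≠ 0) :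
    kirillovKernel ψ Λ a b c d * kirillovKernel ψ Λ a' b' c' d'
      = kirillovKernel ψ Λ (a * a' + b * c') (a * b' + b * d')
          (c * a' + d * c') (c * b' + d * d') := by
  ext x z
  rw [kirillovKernel_mul_aux hE ψ hΛ hc hc' h']
  have hx0 := x.ne_zero
  have hz0 := z.ne_zero
  have hq : (Fintype.card F : ℂ) ≠ 0 := by exact_mod_cast Fintype.card_ne_zero
  set D := a * d - b * c with hD
  set D' := a' * d' - b' * c' with hD'
  by_cases hC : c * a' + d * c' = 0
  · have hd : c * b' + d * d' = -(c * D' / c') := by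
      rw [hD']; field_simp; linear_combination d' * hC
    set d₂ := c * b' + d * d' with hd₂
    have hd₂0 : d₂ ≠ 0 := by
      rw [hd]; exact neg_ne_zero.2 (div_ne_zero (mul_ne_zero hc h') hc')
    have hdet : D * D' = (a * a' + b * c') * d₂ := by
      rw [hD, hD', hd₂]; linear_combination -(a * b' + b * d') * hC
    have hβ : ∀ r : Eˣ, -(algebraMap F E (z / (c * D')) * (r : E) ^ Fintype.card F)
        - algebraMap F E (z / c') = 0 ↔ (r : E) = algebraMap F E d₂ := by
      intro r
      have hp : algebraMap F E (z / (c * D')) ≠ 0 := by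
        simpa using ⟨hc, h'⟩
      have e : algebraMap F E (z / c')
          = -(algebraMap F E (z / (c * D')) * algebraMap F E d₂) := by
        rw [← map_mul, ← map_neg, hd]
        congr 1
        field_simp
      rw [e, sub_neg_eq_add, neg_add_eq_zero, mul_right_inj' hp]
      constructor
      · intro h
        rw [← conj_conj (F := F) hE (r : E), h, ← map_pow, FiniteField.pow_card]
      · intro h
        rw [h, ← map_pow, FiniteField.pow_card]
    have hsum : ∀ r : Eˣ,
        ∑ s : E, ψ ((c * a' + d * c') / (c * c') * z / D' * Algebra.norm F s
            + Algebra.trace F E (s * (-(algebraMap F E (z / (c * D'))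
                * (r : E) ^ Fintype.card F) - algebraMap F E (z / c'))))
        = if (r : E) = algebraMap F E d₂ then (Fintype.card F : ℂ) ^ 2 else 0 := by
      intro r
      simp only [hC, zero_div, zero_mul, zero_add]
      rw [sum_trace hE hψ]
      simp only [hβ]
    simp only [hsum]
    by_cases hxz : (a * a' + b * c') * x = d₂ * z
    · rw [kirillovKernel_of_eq ψ Λ hC hxz]
      have hr0 : algebraMap F E d₂ ≠ 0 := by simpa using hd₂0
      rw [Finset.sum_eq_single (Units.mk0 _ hr0)]
      rotate_left
      · intro r _ hr
        rw [if_neg, mul_zero]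
        intro h
        exact hr (Units.ext h)
      · intro hn
        exfalso
        apply hn
        rw [mem_normFibre, Units.val_mk0, Algebra.norm_algebraMap, hE, mul_assoc, hdet]
        field_simp
        linear_combination -hxz
      rw [Units.val_mk0, if_pos rfl]
      have hph : ψ (a * x / c + d' * z / c') = ψ ((a * b' + b * d') * x / d₂) := by
        congr 1
        have hz : (z : F) = (a * a' + b * c') * x / d₂ := by
          field_simp; linear_combination -hxz
        rw [hz]
        field_simp
        rw [hd₂]
        linear_combination (a * d') * hC
      rw [hph]
      field_simp
    · rw [kirillovKernel_of_ne ψ Λ hC hxz]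
      rw [Finset.sum_eq_zero, mul_zero]
      intro r hr
      rw [if_neg, mul_zero]
      intro h
      apply hxz
      rw [mem_normFibre, h, Algebra.norm_algebraMap, hE, mul_assoc, hdet] at hr
      field_simp at hr
      linear_combination -hr
  · rw [kirillovKernel_of_ne_zero ψ Λ hC, Finset.mul_sum, Finset.mul_sum]
    have hdet : x / z * D * D' = x / z * ((a * a' + b * c') * (c * b' + d * d')
        - (a * b' + b * d') * (c * a' + d * c')) := by rw [hD, hD']; ring
    rw [← hdet]
    refine Finset.sum_congr rfl fun r hr => ?_
    rw [mem_normFibre] at hr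
    set C := c * a' + d * c' with hCdef
    have hα : C / (c * c') * z / D' ≠ 0 :=
      div_ne_zero (mul_ne_zero (div_ne_zero hC (mul_ne_zero hc hc')) hz0) h'
    rw [sum_norm_trace hE hψ hα]
    have hN : Algebra.norm F (-(algebraMap F E (z / (c * D')) * (r : E) ^ Fintype.card F)
        - algebraMap F E (z / c')) = (z / (c * D')) ^ 2 * (x / z * D * D')
          + z / (c * D') * (z / c') * Algebra.trace F E (r : E) + (z / c') ^ 2 := by
      have e : ∀ u v : E, -u - v = -(u + v) := fun u v => by ring
      have e1 : Algebra.norm F (-1 : E) = 1 := by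
        have := Algebra.norm_algebraMap (S := E) (-1 : F)
        rw [hE] at this
        simpa using this
      have e2 : algebraMap F E (z / (c * D')) * (r : E) ^ Fintype.card F
          * (algebraMap F E (z / c')) ^ Fintype.card F
          = (z / (c * D') * (z / c')) • (r : E) ^ Fintype.card F := by
        rw [← map_pow, FiniteField.pow_card, Algebra.smul_def, map_mul]; ring
      rw [e, neg_eq_neg_one_mul, map_mul, e1, one_mul, norm_add_eq hE, e2, map_smul,
        trace_conj hE, map_mul, norm_conj, hr, Algebra.norm_algebraMap, Algebra.norm_algebraMap,
        hE, smul_eq_mul]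
    rw [hN]
    have hph : ψ (a * x / c + d' * z / c') * ψ (-(((z / (c * D')) ^ 2 * (x / z * D * D')
          + z / (c * D') * (z / c') * Algebra.trace F E (r : E) + (z / c') ^ 2)
            / (C / (c * c') * z / D')))
        = ψ (((a * a' + b * c') * x + (c * b' + d * d') * z) / C)
          * ψ (-(z / C * Algebra.trace F E (r : E))) := by
      rw [← AddChar.map_add_eq_mul, ← AddChar.map_add_eq_mul]
      congr 1
      field_simp
      rw [hCdef, hD, hD']
      ring
    have e4 : ∀ u v w k : ℂ, (Fintype.card F : ℂ)⁻¹ ^ 2 * u * (v * (-(Fintype.card F : ℂ) * w))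
        = -(Fintype.card F : ℂ)⁻¹ * v * (u * w) := by
      intro u v w k
      field_simp
    rw [e4 _ _ _ 0, hph]
    ring

/-- The Kirillov matrices multiply. -/
theorem kirillovKernel_mul (hE : Module.finrank F E = 2)
    {ψ : AddChar F ℂ} (hψ : ψ ≠ 1) {Λ : MulChar E ℂ} (hΛ : Λ ^ Fintype.card F ≠ Λ)
    {a b c d : F} (h : a * d - b * c ≠ 0)
    {a' b' c' d' : F} (h' : a' * d' - b' * c' ≠ 0) :
    kirillovKernel ψ Λ a b c d * kirillovKernel ψ Λ a' b' c' d'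
      = kirillovKernel ψ Λ (a * a' + b * c') (a * b' + b * d')
          (c * a' + d * c') (c * b' + d * d') := by
  by_cases hc : c = 0
  · subst hc
    have had : a * d ≠ 0 := by simpa using h
    rw [kirillovKernel_mul_upper_left hE ψ Λ (left_ne_zero_of_mul had)
      (right_ne_zero_of_mul had) h']
    simp
  · by_cases hc' : c' = 0
    · subst hc'
      have had : a' * d' ≠ 0 := by simpa using h'
      rw [kirillovKernel_mul_upper_right hE ψ Λ hc (left_ne_zero_of_mul had)
        (right_ne_zero_of_mul had)]
      simp
    · exact kirillovKernel_mul_generic hE hψ hΛ hc hc' h'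

/-- The cuspidal representation of `GL (2, F)` attached to a character `Λ` of `Eˣ` with
`Λ ^ q ≠ Λ`, in its Kirillov model with respect to the nontrivial additive character `ψ`. It has
dimension `q - 1`, and up to isomorphism it does not depend on `ψ`. Its character takes the values
`(q - 1) * Λ x` at scalars `x`, `-Λ x` at the products of `x` and a nontrivial unipotent, `0` at
elements with two distinct eigenvalues in `F`, and `-(Λ z + Λ (z ^ q))` at elements with an
eigenvalue `z` in `E` outside `F`. -/
noncomputable def cuspidalRep (hE : Module.finrank F E = 2)
    {ψ : AddChar F ℂ} (hψ : ψ ≠ 1) {Λ : MulChar E ℂ} (hΛ : Λ ^ Fintype.card F ≠ Λ) :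
    Representation ℂ (GL (Fin 2) F) (Fˣ → ℂ) where
  toFun g := Matrix.toLin' (kirillovKernel ψ Λ (g 0 0) (g 0 1) (g 1 0) (g 1 1))
  map_one' := by
    have := kirillovKernel_one ψ Λ
    simp [this, Module.End.one_eq_id]
  map_mul' g h := by
    have hd : ∀ g : GL (Fin 2) F, g 0 0 * g 1 1 - g 0 1 * g 1 0 ≠ 0 := by
      intro g
      rw [← Matrix.det_fin_two]
      exact ((Matrix.isUnit_iff_isUnit_det _).1 g.isUnit).ne_zero
    rw [Module.End.mul_eq_comp, ← Matrix.toLin'_mul, kirillovKernel_mul hE hψ hΛ (hd g) (hd h)]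
    simp [Matrix.mul_apply, Fin.sum_univ_two]

end Fields

section Spherical

/-- The averaging operator `f ↦ P_Φ f`, where
`(P_Φ f) g = |K|⁻¹ * ∑ k ∈ K, Φ⁻¹ k * f (k * g)`. -/
noncomputable def sphericalAverage {G : Type*} [Group G] (K : Subgroup G) [Fintype K]
    (Φ : K →* ℂˣ) (f : G → ℂ) (g : G) : ℂ :=
  (Fintype.card K : ℂ)⁻¹ * ∑ k : K, ((Φ k)⁻¹ : ℂˣ) * f (k * g)

variable {F E : Type*} [Field F] [Fintype F] [DecidableEq F]
  [Field E] [Fintype E] [DecidableEq E] [Algebra F E]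

/-- The Coxeter torus `K` of `GL (2, F)`: the matrices, in the basis `b` of `E` over `F`, of the
multiplications by the elements of `Eˣ`. -/
noncomputable abbrev coxeterTorus (b : Module.Basis (Fin 2) F E) : Subgroup (GL (Fin 2) F) :=
  (Units.map (Algebra.leftMulMatrix b : E →* Matrix (Fin 2) (Fin 2) F)).range

/-- The spherical function `ζ^Φ_Λ = P_Φ χ_Λ` of `GL (2, F)` with respect to `K` and `Φ` that
is associated to the cuspidal character `χ_Λ`. -/
noncomputable def cuspidalSphericalFunction (b : Module.Basis (Fin 2) F E)
    (hE : Module.finrank F E = 2) {ψ : AddChar F ℂ} (hψ : ψ ≠ 1)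
    {Λ : MulChar E ℂ} (hΛ : Λ ^ Fintype.card F ≠ Λ) (Φ : coxeterTorus b →* ℂˣ) :
    GL (Fin 2) F → ℂ :=
  sphericalAverage (coxeterTorus b) Φ (cuspidalRep hE hψ hΛ).character

/-- The matrix `d(a, 1)`. -/
def diagOne (a : Fˣ) : GL (Fin 2) F where
  val := !![(a : F), 0; 0, 1]
  inv := !![((a⁻¹ : Fˣ) : F), 0; 0, 1]
  val_inv := by simp [Matrix.one_fin_two]
  inv_val := by simp [Matrix.one_fin_two]

variable (F E) in
/-- The group `U` of elements of norm one of `E` over `F`. -/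
noncomputable abbrev normOne : Subgroup Eˣ :=
  (Units.map (Algebra.norm F : E →* F)).ker

variable (F E) in
/-- The homomorphism `z ↦ z / z̄ = z / z ^ q` from `Eˣ` to `U`. -/
noncomputable def divConj : Eˣ →* normOne F E where
  toFun z := ⟨z / z ^ Fintype.card F, by
    rw [MonoidHom.mem_ker, map_div, map_pow, div_eq_one]
    ext
    rw [Units.val_pow_eq_pow_val, FiniteField.pow_card]⟩
  map_one' := by ext; simp
  map_mul' z w := by
    ext
    simp only [mul_pow, mul_div_mul_comm, Subgroup.coe_mul]

open Classical in
/-- The sign character of the cyclic group `U` of even order: `1` at squares of elements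
of `U` and `-1` elsewhere. -/
noncomputable def signNormOne (u : normOne F E) : ℂ :=
  if IsSquare u then 1 else -1

end Spherical

end FinitePoincare

/-!
At a non-scalar `g` the cuspidal character is `-∑ Λ t`, the sum running over the `t ∈ Eˣ` with
`N(t) = det g` and `Tr(t) = tr g`. Let `g = k d(a, 1)` with `k` in the torus corresponding to
`z ∈ Eˣ`, and exchange the sums over `z` and `t`. For fixed `t`, the `z` that contribute have
prescribed norm `N(t) / a` and trace `2 Tr(t) / (a + 1)`; up to a square, the discriminant of
these conditions is `N(t) (Tr(t / t̄) - (a + a⁻¹))`, because `N(t) (Tr(t / t̄) + 2) = Tr(t)²`,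
and the number of such `z` is `1 - ε(discriminant)`. The constant `1` contributes nothing since
`∑ Λ t = 0`. What remains is an average over `t ∈ Eˣ` of a function of `t / t̄`: the map
`t ↦ t / t̄` has kernel `Fˣ`, hence, by counting, image `U`, and `ε(N(t))` is the sign character
of `U` at `t / t̄`, because `N(t)` is a square in `F` exactly when `t / t̄` is a square in `U`.
-/

namespace FinitePoincare

section FiniteGroups

variable {G H : Type*} [Group G] [Group H]

theorem sum_comp_of_surjective [Fintype G] [Fintype H] {M : Type*} [AddCommMonoid M]
    {φ : G →* H} (hφ : Function.Surjective φ) (f : H → M) :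
    ∑ g, f (φ g) = Nat.card φ.ker • ∑ h, f h := by
  classical
  rw [← Finset.sum_fiberwise Finset.univ φ, Finset.smul_sum]
  refine Finset.sum_congr rfl fun h _ => ?_
  have card_fiber : (Finset.univ.filter fun g => φ g = h).card = Nat.card φ.ker :=
    (Nat.subtype_card _ fun g => by simp).symm.trans
      (Nat.card_congr (φ.fiberEquivKerOfSurjective hφ h))
  rw [Finset.sum_congr rfl fun g hg => by rw [(Finset.mem_filter.1 hg).2], Finset.sum_const,
    card_fiber]

theorem average_comp_of_surjective [Fintype G] [Fintype H] {φ : G →* H}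
    (hφ : Function.Surjective φ) (f : H → ℂ) :
    (Fintype.card G : ℂ)⁻¹ * ∑ g, f (φ g) = (Fintype.card H : ℂ)⁻¹ * ∑ h, f h := by
  have card_eq : (Fintype.card G : ℂ) = Nat.card φ.ker * Fintype.card H := by
    simpa using sum_comp_of_surjective hφ fun _ => (1 : ℂ)
  have card_ker_ne_zero : (Nat.card φ.ker : ℂ) ≠ 0 := Nat.cast_ne_zero.2 Nat.card_pos.ne'
  rw [sum_comp_of_surjective hφ, card_eq, nsmul_eq_mul]
  field_simp

theorem sphericalAverage_range_one [Fintype H] {φ : H →* G} (hφ : Function.Injective φ)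
    [Fintype φ.range] (f : G → ℂ) (g : G) :
    sphericalAverage φ.range 1 f g = (Fintype.card H : ℂ)⁻¹ * ∑ h, f (φ h * g) := by
  let e : H ≃* φ.range := MonoidHom.ofInjective hφ
  simp only [sphericalAverage, MonoidHom.one_apply, inv_one, Units.val_one, one_mul]
  rw [← Fintype.card_congr e.toEquiv]
  exact congrArg _ (Fintype.sum_equiv e.toEquiv _ _ fun _ => rfl).symm

theorem existsUnique_comp_eq_of_ker_le {A : Type*} [Group A] {φ : G →* H}
    (hφ : Function.Surjective φ) {χ : G →* A} (hχ : φ.ker ≤ χ.ker) :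
    ∃! ω : H →* A, ω.comp φ = χ :=
  ⟨φ.liftOfSurjective hφ ⟨χ, hχ⟩, φ.liftOfRightInverse_comp _ _ ⟨χ, hχ⟩,
    fun ω hω => φ.eq_liftOfRightInverse _ _ χ hχ ω hω⟩

end FiniteGroups

section QuadraticExtensions

variable {R S : Type*} [CommRing R] [CommRing S] [Algebra R S] (b : Module.Basis (Fin 2) R S)

include b in
theorem sq_sub_trace_smul_add_norm (z : S) :
    z ^ 2 - Algebra.trace R S z • z + algebraMap R S (Algebra.norm R z) = 0 := by
  nontriviality S
  have := Module.nontrivial R S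
  apply Algebra.leftMulMatrix_injective b
  have := Matrix.aeval_self_charpoly (Algebra.leftMulMatrix b z)
  rw [Matrix.charpoly_fin_two] at this
  simpa [Algebra.trace_eq_matrix_trace b, Algebra.norm_eq_matrix_det b, Algebra.smul_def] using this

theorem leftMulMatrix_eq (hb0 : b 0 = 1) (hb1 : Algebra.trace R S (b 1) = 0) (z : S) :
    Algebra.leftMulMatrix b z = !![b.repr z 0, -Algebra.norm R (b 1) * b.repr z 1;
      b.repr z 1, b.repr z 0] := by
  have basis_one : Algebra.leftMulMatrix b (b 1) = !![0, -Algebra.norm R (b 1); 1, 0] := by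
    have col_zero : ∀ i, Algebra.leftMulMatrix b (b 1) i 0 = if i = 1 then 1 else 0 := by
      intro i
      rw [Algebra.leftMulMatrix_eq_repr_mul, hb0, mul_one, b.repr_self, Finsupp.single_apply]
      simp only [eq_comm]
    have trace_eq := hb1
    rw [Algebra.trace_eq_matrix_trace b, Matrix.trace_fin_two, col_zero] at trace_eq
    rw [Algebra.norm_eq_matrix_det b, Matrix.det_fin_two, col_zero, col_zero]
    ext i j
    fin_cases i <;> fin_cases j <;> simp_all
  have z_eq : z = b.repr z 0 • 1 + b.repr z 1 • b 1 := by
    rw [← hb0, ← Fin.sum_univ_two fun i => b.repr z i • b i, b.sum_repr]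
  conv_lhs => rw [z_eq, map_add, map_smul, map_smul, map_one, basis_one, Matrix.one_fin_two]
  ext i j
  fin_cases i <;> fin_cases j <;> simp [mul_comm]

variable {b}

theorem trace_eq_two_mul_repr (hb0 : b 0 = 1) (hb1 : Algebra.trace R S (b 1) = 0) (z : S) :
    Algebra.trace R S z = 2 * b.repr z 0 := by
  rw [Algebra.trace_eq_matrix_trace b, leftMulMatrix_eq b hb0 hb1, Matrix.trace_fin_two_of, two_mul]

theorem norm_eq_repr_sq (hb0 : b 0 = 1) (hb1 : Algebra.trace R S (b 1) = 0) (z : S) :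
    Algebra.norm R z = b.repr z 0 ^ 2 + Algebra.norm R (b 1) * b.repr z 1 ^ 2 := by
  rw [Algebra.norm_eq_matrix_det b, leftMulMatrix_eq b hb0 hb1, Matrix.det_fin_two_of]
  ring

variable {K L : Type*} [Field K] [Field L] [Algebra K L]

theorem not_isSquare_neg_norm {b : Module.Basis (Fin 2) K L} (hb0 : b 0 = 1)
    (hb1 : Algebra.trace K L (b 1) = 0) : ¬ IsSquare (-Algebra.norm K (b 1)) := by
  rintro ⟨s, hs⟩
  have norm_eq_zero : Algebra.norm K (s • b 0 + b 1) = 0 := by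
    rw [norm_eq_repr_sq hb0 hb1]
    simp only [map_add, map_smul, b.repr_self, Finsupp.add_apply, Finsupp.smul_apply]
    simp only [Finsupp.single_eq_same, smul_eq_mul, mul_one, ne_eq, zero_ne_one, not_false_eq_true,
      Finsupp.single_eq_of_ne, add_zero, one_ne_zero, mul_zero, zero_add, one_pow]
    linear_combination -hs
  have := Module.Finite.of_basis b
  have repr_one_eq_zero : b.repr (s • b 0 + b 1) 1 = 0 := by
    rw [Algebra.norm_eq_zero_iff.1 norm_eq_zero, map_zero, Finsupp.zero_apply]
  simp at repr_one_eq_zero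

theorem norm_eq_mul_and_trace_eq_add_iff (hL : Module.finrank K L = 2) {x y : K} {t : L} :
    Algebra.norm K t = x * y ∧ Algebra.trace K L t = x + y ↔ x = y ∧ t = algebraMap K L x := by
  have trace_coe (r : K) : Algebra.trace K L (algebraMap K L r) = 2 * r := by
    rw [Algebra.trace_algebraMap, hL, two_nsmul, two_mul]
  constructor
  · rintro ⟨norm_eq, trace_eq⟩
    have root : (t - algebraMap K L x) * (t - algebraMap K L y) = 0 := by
      have := Module.finite_of_finrank_pos (hL ▸ two_pos)
      have quadratic := sq_sub_trace_smul_add_norm (Module.finBasisOfFinrankEq K L hL) t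
      rw [norm_eq, trace_eq, Algebra.smul_def, map_add, map_mul] at quadratic
      linear_combination quadratic
    rcases mul_eq_zero.1 root with h | h <;> rw [sub_eq_zero.1 h, trace_coe] at trace_eq
    · exact ⟨by linear_combination trace_eq, sub_eq_zero.1 h⟩
    · have x_eq_y : x = y := by linear_combination -trace_eq
      exact ⟨x_eq_y, x_eq_y ▸ sub_eq_zero.1 h⟩
  · rintro ⟨rfl, rfl⟩
    rw [Algebra.norm_algebraMap, trace_coe, hL, sq, two_mul]
    exact ⟨rfl, rfl⟩

end QuadraticExtensions

section FiniteFields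

variable {F E : Type*} [Field F] [Fintype F] [Field E] [Algebra F E]

theorem mem_zpowers_frobenius [Finite E] (σ : Gal(E/F)) :
    σ ∈ Subgroup.zpowers (FiniteField.frobeniusAlgEquivOfAlgebraic F E) := by
  obtain ⟨n, rfl⟩ := (FiniteField.bijective_frobeniusAlgEquivOfAlgebraic_pow F E).surjective σ
  exact Subgroup.npow_mem_zpowers _ _

theorem pow_card_eq_self_iff [Finite E] (z : E) :
    z ^ Fintype.card F = z ↔ z ∈ Set.range (algebraMap F E) := by
  constructor
  · intro hz
    rw [IsGalois.mem_range_algebraMap_iff_fixed]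
    intro σ
    have frobenius_mem : FiniteField.frobeniusAlgEquivOfAlgebraic F E ∈
        MulAction.stabilizer Gal(E/F) z := hz
    exact (Subgroup.zpowers_le.2 frobenius_mem) (mem_zpowers_frobenius σ)
  · rintro ⟨x, rfl⟩
    rw [← map_pow, FiniteField.pow_card]

theorem divConj_coe [Finite E] (z : Eˣ) :
    ((divConj F E z : Eˣ) : E) = z / (z : E) ^ Fintype.card F := by
  simp [divConj]

theorem ker_divConj [Finite E] :
    (divConj F E).ker = (Units.map (algebraMap F E : F →* E)).range := by
  ext z
  have mem_ker_iff_fixed : z ∈ (divConj F E).ker ↔ (z : E) ^ Fintype.card F = z := by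
    rw [MonoidHom.mem_ker, ← Subtype.coe_inj, ← Units.val_inj, divConj_coe, Subgroup.coe_one,
      Units.val_one, div_eq_one_iff_eq (pow_ne_zero _ z.ne_zero), eq_comm]
  rw [mem_ker_iff_fixed, pow_card_eq_self_iff]
  refine ⟨fun ⟨x, hx⟩ => ⟨Units.mk0 x ?_, Units.ext hx⟩, fun ⟨x, hx⟩ => ⟨x, congrArg Units.val hx⟩⟩
  rintro rfl
  exact z.ne_zero (by rw [← hx, map_zero])

omit [Fintype F] in
theorem norm_coe_normOne (u : normOne F E) : Algebra.norm F ((u : Eˣ) : E) = 1 :=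
  congrArg Units.val (MonoidHom.mem_ker.1 u.2)

omit [Fintype F] in
theorem natCard_normOne_mul [Finite E] :
    Nat.card (normOne F E) * Nat.card Fˣ = Nat.card Eˣ := by
  rw [← Subgroup.card_mul_index (normOne F E), Subgroup.index_ker,
    MonoidHom.range_eq_top.2 (FiniteField.unitsMap_norm_surjective F E), Subgroup.card_top]

theorem divConj_surjective [Finite E] : Function.Surjective (divConj F E) := by
  have natCard_ker : Nat.card (divConj F E).ker = Nat.card Fˣ := by
    rw [ker_divConj]
    exact (Nat.card_congr (MonoidHom.ofInjective
      (Units.map_injective (algebraMap F E).injective)).toEquiv).symm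
  refine MonoidHom.surjective_of_card_ker_le_div _ ?_
  rw [natCard_ker, ← natCard_normOne_mul (F := F) (E := E), Nat.mul_div_cancel_left _ Nat.card_pos]

theorem existsUnique_normOne_character [Finite E] (Λ : MulChar E ℂ)
    (hΛF : ∀ x : Fˣ, Λ (algebraMap F E x) = 1) :
    ∃! ω : normOne F E →* ℂˣ, ∀ z : Eˣ, (ω (divConj F E z) : ℂ) = Λ z := by
  have ker_le : (divConj F E).ker ≤ Λ.toUnitHom.ker := by
    rw [ker_divConj]
    rintro _ ⟨x, rfl⟩
    exact Units.ext (hΛF x)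
  convert existsUnique_comp_eq_of_ker_le divConj_surjective ker_le using 2 with ω
  simp only [MonoidHom.ext_iff, ← Units.val_inj, MonoidHom.comp_apply, MulChar.coe_toUnitHom]

theorem card_normOne [Finite E] [Fintype (normOne F E)] (hE : Module.finrank F E = 2) :
    Fintype.card (normOne F E) = Fintype.card F + 1 := by
  have card_mul := natCard_normOne_mul (F := F) (E := E)
  rw [Nat.card_units, Nat.card_units, Module.natCard_eq_pow_finrank (K := F) (V := E), hE,
    Nat.card_eq_fintype_card, Nat.card_eq_fintype_card, ← Nat.one_pow 2, Nat.sq_sub_sq,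
    Nat.one_pow] at card_mul
  exact Nat.eq_of_mul_eq_mul_right (Nat.sub_pos_of_lt Fintype.one_lt_card) card_mul

section Quadratic

variable [Finite E] (hE : Module.finrank F E = 2)
include hE

theorem algebraMap_trace (s : E) :
    algebraMap F E (Algebra.trace F E s) = s + s ^ Fintype.card F := by
  simpa [hE, Finset.sum_range_succ] using FiniteField.algebraMap_trace_eq_sum_pow F E s

theorem algebraMap_norm (s : E) :
    algebraMap F E (Algebra.norm F s) = s * s ^ Fintype.card F := by
  have := Fintype.ofFinite E
  classical exact (mul_conj hE s).symm

theorem norm_mul_trace_divConj_add_two (t : Eˣ) :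
    Algebra.norm F (t : E) * (Algebra.trace F E ((divConj F E t : Eˣ) : E) + 2)
      = Algebra.trace F E (t : E) ^ 2 := by
  have := Fintype.ofFinite E
  classical
  have t_ne_zero := t.ne_zero
  apply (algebraMap F E).injective
  rw [map_mul, map_add, map_pow, map_ofNat, algebraMap_norm hE, algebraMap_trace hE,
    algebraMap_trace hE, divConj_coe, div_pow, conj_conj hE]
  field_simp
  ring

theorem divConj_normOne (u : normOne F E) : divConj F E u = u ^ 2 := by
  have mul_conj_eq_one : ((u : Eˣ) : E) * ((u : Eˣ) : E) ^ Fintype.card F = 1 := by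
    rw [← algebraMap_norm hE, norm_coe_normOne, map_one]
  refine Subtype.ext (Units.ext ?_)
  rw [divConj_coe, Subgroup.coe_pow, Units.val_pow_eq_pow_val,
    div_eq_iff (pow_ne_zero _ (u : Eˣ).ne_zero)]
  linear_combination -((u : Eˣ) : E) * mul_conj_eq_one

theorem isSquare_divConj_iff (t : Eˣ) :
    IsSquare (divConj F E t) ↔ IsSquare (Algebra.norm F (t : E)) := by
  constructor
  · rintro ⟨u, hu⟩
    obtain ⟨s, rfl⟩ := divConj_surjective u
    obtain ⟨x, hx⟩ : t / s ^ 2 ∈ (Units.map (algebraMap F E : F →* E)).range := by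
      rw [← ker_divConj, MonoidHom.mem_ker, map_div, map_pow, hu, sq, div_self']
    have t_eq : (t : E) = algebraMap F E x * (s : E) ^ 2 := by
      simpa using congrArg Units.val (div_eq_iff_eq_mul.1 hx.symm)
    rw [t_eq, map_mul, Algebra.norm_algebraMap, hE, map_pow, ← mul_pow]
    exact IsSquare.sq _
  · rintro ⟨c, hc⟩
    have norm_ne_zero : Algebra.norm F (t : E) ≠ 0 := Algebra.norm_ne_zero_iff.2 t.ne_zero
    have c_ne_zero : c ≠ 0 := by rintro rfl; simp [hc] at norm_ne_zero
    let x : Eˣ := Units.map (algebraMap F E : F →* E) (Units.mk0 c c_ne_zero)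
    have divConj_x : divConj F E x = 1 := by
      rw [← MonoidHom.mem_ker, ker_divConj]
      exact ⟨_, rfl⟩
    have norm_div_x : Algebra.norm F ((t / x : Eˣ) : E) = 1 := by
      have norm_x : Algebra.norm F (x : E) = c ^ 2 := by
        rw [← hE]
        exact Algebra.norm_algebraMap c
      rw [Units.val_div_eq_div_val, div_eq_mul_inv, map_mul, Algebra.norm_inv, hc, norm_x]
      field_simp
    have divConj_eq_sq :
        divConj F E t = ⟨t / x, MonoidHom.mem_ker.2 (Units.ext norm_div_x)⟩ ^ 2 := by
      rw [← divConj_normOne hE, map_div, divConj_x, div_one]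
    rw [divConj_eq_sq]
    exact IsSquare.sq _

omit [Finite E] in
theorem quadraticChar_norm [DecidableEq F] [Fintype E] [DecidableEq E] (t : Eˣ) :
    (quadraticChar F (Algebra.norm F (t : E)) : ℂ) = signNormOne (divConj F E t) := by
  have norm_ne_zero : Algebra.norm F (t : E) ≠ 0 := Algebra.norm_ne_zero_iff.2 t.ne_zero
  rw [signNormOne]
  split_ifs with h
  · rw [(quadraticChar_one_iff_isSquare norm_ne_zero).2 ((isSquare_divConj_iff hE t).1 h),
      Int.cast_one]
  · rw [quadraticChar_neg_one_iff_not_isSquare.2 (mt (isSquare_divConj_iff hE t).2 h),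
      Int.cast_neg, Int.cast_one]

end Quadratic

end FiniteFields

section CuspidalCharacter

variable {F E : Type*} [Field F] [Fintype F] [DecidableEq F]
  [Field E] [Fintype E] [DecidableEq E] [Algebra F E]

/-- The elements of `Eˣ` of norm `n` and trace `T`. When `E` is quadratic over `F`, they are the
roots of `X ^ 2 - T * X + n` in `Eˣ`, those in `F` being discarded unless they are double. -/
noncomputable def normTraceFibre (n T : F) : Finset Eˣ :=
  (normFibre n).filter fun t : Eˣ => Algebra.trace F E (t : E) = T

omit [Fintype F] in
theorem mem_normTraceFibre {n T : F} {t : Eˣ} :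
    t ∈ normTraceFibre (E := E) n T ↔
      Algebra.norm F (t : E) = n ∧ Algebra.trace F E (t : E) = T := by
  simp only [normTraceFibre, normFibre, Finset.mem_filter, Finset.mem_univ, true_and]

theorem sum_units_mulShift {ψ : AddChar F ℂ} (hψ : ψ ≠ 1) (T : F) :
    ∑ x : Fˣ, ψ (x * T) = (if T = 0 then (Fintype.card F : ℂ) else 0) - 1 := by
  rw [sum_units fun x : F => ψ (x * T), AddChar.sum_mulShift _ (.of_ne_one hψ), zero_mul,
    AddChar.map_zero_eq_one, Nat.cast_ite, Nat.cast_zero]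

theorem sum_units_eq_zero {K : Type*} [Field K] [Fintype K] [DecidableEq K] {Λ : MulChar K ℂ}
    (hΛ : Λ ≠ 1) :
    ∑ t : Kˣ, Λ t = 0 := by
  rw [sum_units, MulChar.sum_eq_zero_of_ne_one hΛ, MulChar.map_zero, sub_zero]

theorem kirillovKernel_diag {ψ : AddChar F ℂ} {Λ : MulChar E ℂ} {a b c d : F} (hc : c ≠ 0)
    (x : Fˣ) :
    kirillovKernel ψ Λ a b c d x x = -(Fintype.card F : ℂ)⁻¹ *
      ∑ t ∈ normFibre (E := E) (a * d - b * c),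
        Λ t * ψ (x * ((a + d - Algebra.trace F E (t : E)) / c)) := by
  rw [kirillovKernel_of_ne_zero ψ Λ hc, div_self x.ne_zero, one_mul, mul_assoc, Finset.mul_sum]
  refine congrArg _ (Finset.sum_congr rfl fun t _ => ?_)
  rw [mul_left_comm, ← AddChar.map_add_eq_mul]
  congr 2
  ring

theorem trace_kirillovKernel_of_ne_zero {ψ : AddChar F ℂ} (hψ : ψ ≠ 1) {Λ : MulChar E ℂ}
    (hΛ : Λ ^ Fintype.card F ≠ Λ) {a b c d : F} (hc : c ≠ 0) :
    (kirillovKernel ψ Λ a b c d).trace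
      = -∑ t ∈ normTraceFibre (E := E) (a * d - b * c) (a + d), Λ t := by
  have q_ne_zero : (Fintype.card F : ℂ) ≠ 0 := Nat.cast_ne_zero.2 Fintype.card_ne_zero
  have shift_eq_zero_iff (t : Eˣ) :
      (a + d - Algebra.trace F E (t : E)) / c = 0 ↔ Algebra.trace F E (t : E) = a + d := by
    rw [div_eq_zero_iff, or_iff_left hc, sub_eq_zero, eq_comm]
  simp only [Matrix.trace, Matrix.diag, kirillovKernel_diag hc, ← Finset.mul_sum]
  rw [Finset.sum_comm]
  simp only [← Finset.mul_sum, sum_units_mulShift hψ, shift_eq_zero_iff, mul_sub_one,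
    Finset.sum_sub_distrib, sum_norm_fibre_eq_zero hΛ, sub_zero, mul_ite, mul_zero]
  rw [← Finset.sum_filter, ← normTraceFibre, ← Finset.sum_mul]
  field_simp

theorem trace_kirillovKernel_upperTriangular (hE : Module.finrank F E = 2) {ψ : AddChar F ℂ}
    (hψ : ψ ≠ 1) {Λ : MulChar E ℂ} {a b d : F} (hd : d ≠ 0) (h : a ≠ d ∨ b ≠ 0) :
    (kirillovKernel ψ Λ a b 0 d).trace
      = -∑ t ∈ normTraceFibre (E := E) (a * d) (a + d), Λ t := by
  rcases eq_or_ne a d with rfl | a_ne_d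
  · have fibre_eq : normTraceFibre (E := E) (a * a) (a + a)
        = {Units.map (algebraMap F E : F →* E) (Units.mk0 a hd)} := by
      ext t
      rw [mem_normTraceFibre, norm_eq_mul_and_trace_eq_add_iff hE, Finset.mem_singleton,
        Units.ext_iff]
      exact and_iff_right rfl
    have b_div_ne_zero : b / a ≠ 0 := div_ne_zero (h.resolve_left (· rfl)) hd
    rw [fibre_eq, Finset.sum_singleton]
    have kernel_diag (x : Fˣ) :
        kirillovKernel ψ Λ a b 0 a x x = Λ (algebraMap F E a) * ψ (x * (b / a)) := by
      rw [kirillovKernel_of_eq ψ Λ rfl rfl, mul_comm b, mul_div_assoc]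
    simp only [Matrix.trace, Matrix.diag, kernel_diag, ← Finset.mul_sum, sum_units_mulShift hψ,
      if_neg b_div_ne_zero, zero_sub, mul_neg_one]
    rfl
  · have fibre_eq : normTraceFibre (E := E) (a * d) (a + d) = ∅ := by
      ext t
      rw [mem_normTraceFibre, norm_eq_mul_and_trace_eq_add_iff hE]
      simp [a_ne_d]
    rw [fibre_eq, Finset.sum_empty, neg_zero]
    exact Finset.sum_eq_zero fun x _ =>
      kirillovKernel_of_ne ψ Λ rfl fun hx => a_ne_d (mul_right_cancel₀ x.ne_zero hx)

theorem character_cuspidalRep (hE : Module.finrank F E = 2) {ψ : AddChar F ℂ} (hψ : ψ ≠ 1)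
    {Λ : MulChar E ℂ} (hΛ : Λ ^ Fintype.card F ≠ Λ) (g : GL (Fin 2) F) :
    (cuspidalRep hE hψ hΛ).character g
      = (kirillovKernel ψ Λ (g 0 0) (g 0 1) (g 1 0) (g 1 1)).trace :=
  Matrix.trace_toLin'_eq _

theorem character_cuspidalRep_of_notMem_center (hE : Module.finrank F E = 2) {ψ : AddChar F ℂ}
    (hψ : ψ ≠ 1) {Λ : MulChar E ℂ} (hΛ : Λ ^ Fintype.card F ≠ Λ) {g : GL (Fin 2) F}
    (hg : g ∉ Subgroup.center (GL (Fin 2) F)) :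
    (cuspidalRep hE hψ hΛ).character g
      = -∑ t ∈ normTraceFibre (E := E) g.val.det g.val.trace, Λ t := by
  rw [character_cuspidalRep, Matrix.det_fin_two, Matrix.trace_fin_two]
  by_cases lower_left : g 1 0 = 0
  · have det_ne_zero : g 0 0 * g 1 1 ≠ 0 := by
      have := g.det.ne_zero
      rwa [Matrix.GeneralLinearGroup.val_det_apply, Matrix.det_fin_two, lower_left, mul_zero,
        sub_zero] at this
    rw [lower_left, mul_zero, sub_zero]
    refine trace_kirillovKernel_upperTriangular hE hψ (right_ne_zero_of_mul det_ne_zero) ?_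
    contrapose! hg
    refine Matrix.GeneralLinearGroup.mem_center_iff_val_mem_range_scalar.2 ⟨g 0 0, ?_⟩
    ext i j
    fin_cases i <;> fin_cases j <;> simp [lower_left, hg]
  · exact trace_kirillovKernel_of_ne_zero hψ hΛ lower_left

end CuspidalCharacter

section CoxeterTorus

variable {F E : Type*} [Field F] [Field E] [Algebra F E] (b : Module.Basis (Fin 2) F E)

/-- The embedding of `Eˣ` into `GL (2, F)`, in the basis `b`, whose image is the Coxeter torus. -/
noncomputable def coxeterEmbedding : Eˣ →* GL (Fin 2) F :=
  Units.map (Algebra.leftMulMatrix b : E →* Matrix (Fin 2) (Fin 2) F)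

theorem coxeterEmbedding_injective : Function.Injective (coxeterEmbedding b) :=
  Units.map_injective (Algebra.leftMulMatrix_injective b)

variable {b}

theorem val_coxeterEmbedding_mul_diagOne (hb0 : b 0 = 1) (hb1 : Algebra.trace F E (b 1) = 0)
    (z : Eˣ) (a : Fˣ) :
    (coxeterEmbedding b z * diagOne a).val
      = !![a * b.repr z 0, -Algebra.norm F (b 1) * b.repr z 1;
        a * b.repr z 1, b.repr z 0] := by
  rw [Units.val_mul, coxeterEmbedding, Units.coe_map, MonoidHom.coe_coe, leftMulMatrix_eq b hb0 hb1]
  simp [diagOne, mul_comm]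

theorem coxeterEmbedding_mul_diagOne_notMem_center (hb0 : b 0 = 1)
    (hb1 : Algebra.trace F E (b 1) = 0) (z : Eˣ) {a : Fˣ} (ha : a ≠ 1) :
    coxeterEmbedding b z * diagOne a ∉ Subgroup.center (GL (Fin 2) F) := by
  rw [Matrix.GeneralLinearGroup.mem_center_iff_val_mem_range_scalar,
    val_coxeterEmbedding_mul_diagOne hb0 hb1]
  rintro ⟨s, scalar_eq⟩
  have lower_left : a * b.repr (z : E) 1 = 0 := by simpa using (congrFun₂ scalar_eq 1 0).symm
  have diag_eq : a * b.repr (z : E) 0 = b.repr (z : E) 0 := by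
    simpa using (congrFun₂ scalar_eq 0 0).symm.trans (congrFun₂ scalar_eq 1 1)
  have repr_one : b.repr (z : E) 1 = 0 := (mul_eq_zero_iff_left a.ne_zero).1 lower_left
  have repr_zero : b.repr (z : E) 0 = 0 := by
    by_contra repr_zero_ne_zero
    exact ha (Units.ext (mul_eq_right₀ repr_zero_ne_zero |>.1 diag_eq))
  refine z.ne_zero (b.ext_elem fun i => ?_)
  fin_cases i <;> simp [repr_zero, repr_one]

theorem det_coxeterEmbedding_mul_diagOne (z : Eˣ) (a : Fˣ) :
    (coxeterEmbedding b z * diagOne a).val.det = a * Algebra.norm F (z : E) := by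
  rw [Units.val_mul, Matrix.det_mul, coxeterEmbedding, Units.coe_map, MonoidHom.coe_coe,
    ← Algebra.norm_eq_matrix_det, mul_comm]
  simp [diagOne]

theorem trace_coxeterEmbedding_mul_diagOne (hb0 : b 0 = 1) (hb1 : Algebra.trace F E (b 1) = 0)
    (z : Eˣ) (a : Fˣ) :
    2 * (coxeterEmbedding b z * diagOne a).val.trace = (a + 1) * Algebra.trace F E (z : E) := by
  rw [val_coxeterEmbedding_mul_diagOne hb0 hb1, Matrix.trace_fin_two_of,
    trace_eq_two_mul_repr hb0 hb1]
  ring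

-- The square of the second coordinate is displayed as the discriminant times the nonsquare
-- `-N(δ)` times a square, so that its quadratic character can be read off.
theorem norm_eq_and_trace_eq_iff_repr (two_ne_zero : (2 : F) ≠ 0) (hb0 : b 0 = 1)
    (hb1 : Algebra.trace F E (b 1) = 0) {n T : F} {z : E} :
    Algebra.norm F z = n ∧ Algebra.trace F E z = T ↔ b.repr z 0 = T / 2 ∧
      b.repr z 1 ^ 2 = (T ^ 2 - 4 * n) * (-Algebra.norm F (b 1)) *
        (2 * Algebra.norm F (b 1))⁻¹ ^ 2 := by
  have norm_ne_zero : Algebra.norm F (b 1) ≠ 0 := by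
    have := Module.Finite.of_basis b
    exact Algebra.norm_ne_zero_iff.2 (b.ne_zero 1)
  rw [norm_eq_repr_sq hb0 hb1, trace_eq_two_mul_repr hb0 hb1]
  constructor
  · rintro ⟨rfl, rfl⟩
    constructor
    · field_simp
    · field_simp
      ring
  · rintro ⟨repr_zero, repr_one_sq⟩
    rw [repr_zero, repr_one_sq]
    constructor
    · field_simp
      ring
    · field_simp

theorem card_normTraceFibre [Fintype F] [DecidableEq F] [Fintype E] [DecidableEq E]
    (hF : ringChar F ≠ 2) (hb0 : b 0 = 1) (hb1 : Algebra.trace F E (b 1) = 0)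
    {n : F} (hn : n ≠ 0) (T : F) :
    ((normTraceFibre (E := E) n T).card : ℤ) = 1 - quadraticChar F (T ^ 2 - 4 * n) := by
  have two_ne_zero : (2 : F) ≠ 0 := Ring.two_ne_zero hF
  have norm_ne_zero : Algebra.norm F (b 1) ≠ 0 := Algebra.norm_ne_zero_iff.2 (b.ne_zero 1)
  have card_sqrts := quadraticChar_card_sqrts hF
    ((T ^ 2 - 4 * n) * (-Algebra.norm F (b 1)) * (2 * Algebra.norm F (b 1))⁻¹ ^ 2)
  rw [map_mul, map_mul, quadraticChar_sq_one' (inv_ne_zero (mul_ne_zero two_ne_zero norm_ne_zero)),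
    quadraticChar_neg_one_iff_not_isSquare.2 (not_isSquare_neg_norm hb0 hb1), mul_neg_one, mul_one,
    neg_add_eq_sub] at card_sqrts
  rw [← card_sqrts]
  congr 1
  have mem_iff (z : Eˣ) := (mem_normTraceFibre (n := n) (T := T) (t := z)).trans
    (norm_eq_and_trace_eq_iff_repr two_ne_zero hb0 hb1)
  refine Finset.card_bij (fun z _ => b.repr (z : E) 1) (fun z hz => ?_) (fun z hz w hw h => ?_)
    (fun y hy => ?_)
  · exact Set.mem_toFinset.2 ((mem_iff z).1 hz).2
  · have repr_zero_eq := ((mem_iff z).1 hz).1.trans ((mem_iff w).1 hw).1.symm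
    refine Units.ext (b.ext_elem fun i => ?_)
    fin_cases i
    exacts [repr_zero_eq, h]
  · have norm_trace := (norm_eq_and_trace_eq_iff_repr (n := n) (T := T)
      (z := b.equivFun.symm ![T / 2, y]) two_ne_zero hb0 hb1).2
        ⟨by simp, by simpa using Set.mem_toFinset.1 hy⟩
    have z_ne_zero : b.equivFun.symm ![T / 2, y] ≠ 0 :=
      Algebra.norm_ne_zero_iff.1 (norm_trace.1.trans_ne hn)
    exact ⟨Units.mk0 _ z_ne_zero, mem_normTraceFibre.2 norm_trace, by simp⟩

theorem card_coxeterEmbedding_fibre [Fintype F] [DecidableEq F] [Fintype E] [DecidableEq E]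
    (hF : ringChar F ≠ 2) (hb0 : b 0 = 1) (hb1 : Algebra.trace F E (b 1) = 0) {a : Fˣ}
    (ha : a ≠ -1) (t : Eˣ) :
    ((Finset.univ.filter fun z : Eˣ => t ∈ normTraceFibre (coxeterEmbedding b z * diagOne a).val.det
        (coxeterEmbedding b z * diagOne a).val.trace).card : ℤ)
      = 1 - quadraticChar F (Algebra.trace F E ((divConj F E t : Eˣ) : E) - ((a : F) + (a : F)⁻¹))
        * quadraticChar F (Algebra.norm F (t : E)) := by
  have two_ne_zero : (2 : F) ≠ 0 := Ring.two_ne_zero hF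
  have a_ne_zero : (a : F) ≠ 0 := a.ne_zero
  have a_add_one_ne_zero : (a : F) + 1 ≠ 0 := fun h => ha (Units.ext (eq_neg_of_add_eq_zero_left h))
  set n := Algebra.norm F (t : E)
  set T := Algebra.trace F E (t : E) with T_def
  set w := Algebra.trace F E ((divConj F E t : Eˣ) : E)
  have n_ne_zero : n ≠ 0 := Algebra.norm_ne_zero_iff.2 t.ne_zero
  have fibre_eq : (Finset.univ.filter fun z : Eˣ =>
      t ∈ normTraceFibre (coxeterEmbedding b z * diagOne a).val.det
        (coxeterEmbedding b z * diagOne a).val.trace)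
      = normTraceFibre (n / a) (2 * T / (a + 1)) := by
    ext z
    rw [Finset.mem_filter_univ, mem_normTraceFibre, mem_normTraceFibre,
      det_coxeterEmbedding_mul_diagOne, eq_div_iff a_ne_zero, eq_div_iff a_add_one_ne_zero,
      ← mul_right_inj' two_ne_zero (b := T), trace_coxeterEmbedding_mul_diagOne hb0 hb1, eq_comm,
      eq_comm (a := 2 * T), mul_comm _ (a : F), mul_comm ((a : F) + 1)]
  have discriminant_eq : (2 * T / (a + 1)) ^ 2 - 4 * (n / a)
      = (w - ((a : F) + (a : F)⁻¹)) * n * (2 / (a + 1)) ^ 2 := by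
    have hE : Module.finrank F E = 2 :=
      (Module.finrank_eq_card_basis b).trans (Fintype.card_fin 2)
    rw [div_pow, mul_pow, T_def, ← norm_mul_trace_divConj_add_two hE]
    field_simp
    ring
  rw [fibre_eq, card_normTraceFibre hF hb0 hb1 (div_ne_zero n_ne_zero a_ne_zero), discriminant_eq,
    map_mul, map_mul, quadraticChar_sq_one' (div_ne_zero two_ne_zero a_add_one_ne_zero), mul_one]

theorem cuspidalSphericalFunction_one_diagOne [Fintype F] [DecidableEq F] [Fintype E]
    [DecidableEq E] (hE : Module.finrank F E = 2) (hF : ringChar F ≠ 2) (hb0 : b 0 = 1)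
    (hb1 : Algebra.trace F E (b 1) = 0) {ψ : AddChar F ℂ} (hψ : ψ ≠ 1) {Λ : MulChar E ℂ}
    (hΛ : Λ ^ Fintype.card F ≠ Λ) {a : Fˣ} (ha : a ≠ 1) (ha' : a ≠ -1) :
    cuspidalSphericalFunction b hE hψ hΛ 1 (diagOne a) = (Fintype.card Eˣ : ℂ)⁻¹ * ∑ t : Eˣ,
      (quadraticChar F (Algebra.trace F E ((divConj F E t : Eˣ) : E) - ((a : F) + (a : F)⁻¹)) : ℂ)
        * (quadraticChar F (Algebra.norm F (t : E)) * Λ t) := by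
  have Λ_ne_one : Λ ≠ 1 := by
    rintro rfl
    exact hΛ (one_pow _)
  calc cuspidalSphericalFunction b hE hψ hΛ 1 (diagOne a)
    _ = (Fintype.card Eˣ : ℂ)⁻¹ * ∑ z : Eˣ,
          (cuspidalRep hE hψ hΛ).character (coxeterEmbedding b z * diagOne a) :=
      sphericalAverage_range_one (coxeterEmbedding_injective b) _ _
    _ = (Fintype.card Eˣ : ℂ)⁻¹ * -∑ t : Eˣ, ((Finset.univ.filter fun z : Eˣ =>
          t ∈ normTraceFibre (coxeterEmbedding b z * diagOne a).val.det
            (coxeterEmbedding b z * diagOne a).val.trace).card : ℤ) * Λ t := by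
      congr 1
      simp only [character_cuspidalRep_of_notMem_center hE hψ hΛ
        (coxeterEmbedding_mul_diagOne_notMem_center hb0 hb1 _ ha), Finset.sum_neg_distrib]
      rw [Finset.sum_comm' (t' := Finset.univ) (s' := fun t => Finset.univ.filter fun z : Eˣ =>
        t ∈ normTraceFibre (coxeterEmbedding b z * diagOne a).val.det
          (coxeterEmbedding b z * diagOne a).val.trace) (by simp)]
      simp only [Finset.sum_const, nsmul_eq_mul, Int.cast_natCast]
    _ = _ := by
      simp only [card_coxeterEmbedding_fibre hF hb0 hb1 ha', Int.cast_sub, Int.cast_one,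
        Int.cast_mul, sub_mul, one_mul, Finset.sum_sub_distrib, sum_units_eq_zero Λ_ne_one,
        zero_sub, neg_neg, mul_assoc]

end CoxeterTorus

end FinitePoincare

open FinitePoincare in
theorem mainTheorem10 {F E : Type*} [Field F] [Fintype F] [DecidableEq F]
    [Field E] [Fintype E] [DecidableEq E] [Algebra F E]
    (hE : Module.finrank F E = 2) (hF : ringChar F ≠ 2)
    (b : Module.Basis (Fin 2) F E) (hb0 : b 0 = 1) (hb1 : Algebra.trace F E (b 1) = 0)
    (ψ : AddChar F ℂ) (hψ : ψ ≠ 1)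
    (Λ : MulChar E ℂ) (hΛ : Λ ^ Fintype.card F ≠ Λ)
    (hΛF : ∀ x : Fˣ, Λ (algebraMap F E x) = 1) :
    (∃! ω : normOne F E →* ℂˣ, ∀ z : Eˣ, (ω (divConj F E z) : ℂ) = Λ z) ∧
    ∀ ω : normOne F E →* ℂˣ, (∀ z : Eˣ, (ω (divConj F E z) : ℂ) = Λ z) →
      ∀ a : Fˣ, a ≠ 1 → a ≠ -1 →
        cuspidalSphericalFunction b hE hψ hΛ 1 (diagOne a)
          = ((Fintype.card F : ℂ) + 1)⁻¹ * ∑ u : normOne F E,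
              (quadraticChar F (Algebra.trace F E ((u : Eˣ) : E) - ((a : F) + (a : F)⁻¹)) : ℂ)
                * (signNormOne u * (ω u : ℂ)) := by
  refine ⟨existsUnique_normOne_character Λ hΛF, fun ω hω a ha ha' => ?_⟩
  simp only [cuspidalSphericalFunction_one_diagOne hE hF hb0 hb1 hψ hΛ ha ha',
    quadraticChar_norm hE, ← hω]
  rw [average_comp_of_surjective divConj_surjective fun u : normOne F E =>
    (quadraticChar F (Algebra.trace F E ((u : Eˣ) : E) - ((a : F) + (a : F)⁻¹)) : ℂ)
      * (signNormOne u * (ω u : ℂ)), card_normOne hE, Nat.cast_add_one]
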